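/- Let $d,\gamma\ge 1$ be integers, let $\mathbb{T}=\mathbb{R}/2\pi\mathbb{Z}$, and let $-\Delta_\gamma=-\Delta_x-|x|^{2\gamma}\Delta_y$ be the Baouendi–Grushin operator on $L^2(\mathbb{R}^d\times\mathbb{T}^d)$ (complex-valued functions), with its maximal domain of all $f\in L^2(\mathbb{R}^d\times\mathbb{T}^d)$ such that $\Delta_\gamma f\in L^2(\mathbb{R}^d\times\mathbb{T}^d)$ in the sense of distributions; it is nonnegative and selfadjoint. For $\lambda\in\mathbb{R}$ let $\mathcal{E}_\lambda(-\Delta_\gamma)$ denote its spectral subspace for the interval $(-\infty,\lambda]$, i.e. the range of the spectral projection $\mathbb{1}_{(-\infty,\lambda]}(-\Delta_\gamma)$. **Proposition 2.6.** Let $\omega\subset\mathbb{R}^d\times\mathbb{T}^d$ be a (Lebesgue) measurable set with positive measure, and let $\lambda>0$. If for some constant $c>0$ the spectral inequality $$\forall f\in\mathcal{E}_\lambda(-\Delta_\gamma),\qquad \|f\|_{L^2(\mathbb{R}^d\times\mathbb{T}^d)}\le c\,\|f\|_{L^2(\omega)}$$ holds, then $\omega$ is thick in $\mathbb{R}^d\times\mathbb{T}^d$,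 that is, there are $\theta\in(0,1]$, $L_x>0$ and $L_y\in(0,2\pi]$ such that $$\forall z\in\mathbb{R}^d\times\mathbb{R}^d,\qquad \bigl|\omega\cap\bigl(z+(0,L_x)^d\times(0,L_y)^d\bigr)\bigr|\ge\theta L_x^dL_y^d,$$ where $|\cdot|$ is Lebesgue measure and the box $z+(0,L_x)^d\times(0,L_y)^d$ is identified with its image under the canonical projection $\mathbb{R}^d\times\mathbb{R}^d\to\mathbb{R}^d\times\mathbb{T}^d$. -/

import Mathlib

noncomputable section

namespace Grushin

open MeasureTheory Set


/-! ### Projection-valued measures and spectral subspaces -/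

/-- A projection-valued measure on the Borel sets of `ℝ`, acting on a complex Hilbert space `H`:
values on Borel sets are orthogonal projections, the whole line is sent to the identity, and the
measure is countably additive in the strong operator topology. (Values of `proj` on sets that are
not Borel are irrelevant and never used.) -/
structure ProjValuedMeasure (H : Type*) [NormedAddCommGroup H] [InnerProductSpace ℂ H]
    [CompleteSpace H] where
  proj : Set ℝ → H →L[ℂ] H
  isStarProjection : ∀ B : Set ℝ, MeasurableSet B → IsStarProjection (proj B)
  proj_univ : proj univ = 1
  hasSum_iUnion : ∀ B : ℕ → Set ℝ, (∀ n, MeasurableSet (B n)) →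
    Pairwise (fun m n => Disjoint (B m) (B n)) →
    ∀ f : H, HasSum (fun n => proj (B n) f) (proj (⋃ n, B n) f)

namespace ProjValuedMeasure

variable {H : Type*} [NormedAddCommGroup H] [InnerProductSpace ℂ H] [CompleteSpace H]

theorem proj_empty (E : ProjValuedMeasure H) (f : H) : E.proj ∅ f = 0 := by
  have h := E.hasSum_iUnion (fun _ => ∅) (fun _ => MeasurableSet.empty)
    (fun _ _ _ => disjoint_bot_left) f
  exact tendsto_nhds_unique tendsto_const_nhds h.summable.tendsto_atTop_zero

theorem norm_sq_proj (E : ProjValuedMeasure H) {B : Set ℝ} (hB : MeasurableSet B) (f : H) :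
    ‖E.proj B f‖ ^ 2 = RCLike.re (inner ℂ f (E.proj B f)) := by
  have hp := E.isStarProjection B hB
  have hi : E.proj B (E.proj B f) = E.proj B f :=
    DFunLike.congr_fun hp.isIdempotentElem.eq f
  have ha : ContinuousLinearMap.adjoint (E.proj B) = E.proj B := hp.isSelfAdjoint
  rw [← inner_self_eq_norm_sq (𝕜 := ℂ), ← ContinuousLinearMap.adjoint_inner_right, ha, hi]

/-- The scalar spectral measure `B ↦ ‖E(B) f‖² = ⟨f, E(B) f⟩` of a vector `f`. -/
def scalarMeasure (E : ProjValuedMeasure H) (f : H) : Measure ℝ :=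
  Measure.ofMeasurable (fun B _ => ENNReal.ofReal (‖E.proj B f‖ ^ 2))
    (by simp [E.proj_empty f])
    (by
      intro B hB hd
      have h := E.hasSum_iUnion B hB (fun m n hmn => hd hmn) f
      have h2 : HasSum (fun n => ‖E.proj (B n) f‖ ^ 2) (‖E.proj (⋃ n, B n) f‖ ^ 2) := by
        rw [E.norm_sq_proj (MeasurableSet.iUnion hB)]
        simp_rw [fun n => E.norm_sq_proj (hB n) f]
        exact (h.mapL (innerSL ℂ f)).mapL RCLike.reCLM
      rw [← h2.tsum_eq, ENNReal.ofReal_tsum_of_nonneg (fun _ => by positivity) h2.summable])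

theorem scalarMeasure_apply (E : ProjValuedMeasure H) (f : H) {B : Set ℝ} (hB : MeasurableSet B) :
    E.scalarMeasure f B = ENNReal.ofReal (‖E.proj B f‖ ^ 2) :=
  Measure.ofMeasurable_apply B hB

/-- `E` is the spectral measure of the operator `A`, given by its graph: `A = ∫ t dE(t)`. That is,
the domain of `A` consists of the vectors `f` with `∫ t² d⟨f, E(t) f⟩ < ∞`, and
`⟨f, A f⟩ = ∫ t d⟨f, E(t) f⟩` on the domain (by polarization this determines `A f`). -/
structure IsSpectralMeasureOf (E : ProjValuedMeasure H) (A : Submodule ℂ (H × H)) : Prop where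
  mem_domain_iff : ∀ f : H,
    (∃ g : H, (f, g) ∈ A) ↔ ∫⁻ t, ENNReal.ofReal (t ^ 2) ∂(E.scalarMeasure f) < ⊤
  inner_eq : ∀ f g : H, (f, g) ∈ A →
    inner ℂ f g = ((∫ t, t ∂(E.scalarMeasure f) : ℝ) : ℂ)

end ProjValuedMeasure

/-- The spectral subspace `𝓔_λ(A)`, the range of `𝟙_{(-∞, λ]}(A) = E((-∞, λ])`, where `E` is the
spectral measure of `A`. A self-adjoint operator has exactly one spectral measure by the spectral
theorem, so that the infimum is over a single element in that case. -/
def spectralSubspace {H : Type*} [NormedAddCommGroup H] [InnerProductSpace ℂ H] [CompleteSpace H]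
    (A : Submodule ℂ (H × H)) (lam : ℝ) : Submodule ℂ H :=
  ⨅ (E : ProjValuedMeasure H) (_ : E.IsSpectralMeasureOf A),
    LinearMap.range (E.proj (Iic lam)).toLinearMap

/-! ### The cylinder and the Baouendi–Grushin operator -/

instance fact_two_pi_pos : Fact (0 < 2 * Real.pi) := ⟨Real.two_pi_pos⟩

/-- The torus `𝕋^d` with `𝕋 = ℝ / 2πℤ`, with the (unnormalized) Lebesgue measure. -/
abbrev Torus (d : ℕ) : Type := Fin d → AddCircle (2 * Real.pi)

/-- The cylinder `ℝ^d × 𝕋^d`, with the Lebesgue measure `volume` of total mass `(2π)^d` in `y`. -/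
abbrev Cylinder (d : ℕ) : Type := EuclideanSpace ℝ (Fin d) × Torus d

/-- The canonical projection `ℝ^d → 𝕋^d`. -/
def toTorus {d : ℕ} (v : EuclideanSpace ℝ (Fin d)) : Torus d :=
  fun i => ((v i : ℝ) : AddCircle (2 * Real.pi))

/-- The Hilbert space `L²(ℝ^d × 𝕋^d)` of complex-valued functions. -/
abbrev L2 (d : ℕ) : Type := Lp ℂ 2 (volume : Measure (Cylinder d))

/-- Test functions `C_c^∞(ℝ^d × 𝕋^d)`: compactly supported functions whose lift to `ℝ^d × ℝ^d`
(periodic in the second variable) is smooth. -/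
structure IsTestFunction {d : ℕ} (ψ : Cylinder d → ℂ) : Prop where
  smooth : ContDiff ℝ (⊤ : ℕ∞)
    (fun z : EuclideanSpace ℝ (Fin d) × EuclideanSpace ℝ (Fin d) => ψ (z.1, toTorus z.2))
  compactSupport : HasCompactSupport ψ

/-- The differential expression `Δ_γ ψ = Δ_x ψ + |x|^{2γ} Δ_y ψ`. The Laplacian on the torus is
computed at `y` in the local coordinate `v ↦ y + v`. -/
def grushin (γ : ℕ) {d : ℕ} (ψ : Cylinder d → ℂ) (z : Cylinder d) : ℂ :=
  Laplacian.laplacian (fun x : EuclideanSpace ℝ (Fin d) => ψ (x, z.2)) z.1 +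
    ((‖z.1‖ ^ (2 * γ) : ℝ) : ℂ) *
      Laplacian.laplacian (fun v : EuclideanSpace ℝ (Fin d) => ψ (z.1, z.2 + toTorus v)) 0

/-- The graph of the operator `-Δ_γ` on `L²(ℝ^d × 𝕋^d)`, with its maximal domain of all `f ∈ L²`
such that `-Δ_γ f ∈ L²` in the sense of distributions: `(f, g)` is in the graph if and only if
`⟨-Δ_γ ψ, f⟩ = ⟨ψ, g⟩` for all test functions `ψ`. (In the definition, `u` and `v` are the
classes of `ψ` and `-Δ_γ ψ` in `L²`.) -/
def negGrushinGraph (γ d : ℕ) : Submodule ℂ (L2 d × L2 d) where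
  carrier := {p | ∀ (ψ : Cylinder d → ℂ) (u v : L2 d), IsTestFunction ψ →
    u =ᵐ[volume] ψ → v =ᵐ[volume] (fun z => -grushin γ ψ z) →
    inner ℂ v p.1 = inner ℂ u p.2}
  zero_mem' := by
    intro ψ u v _ _ _
    simp
  add_mem' := by
    intro p q hp hq ψ u v h hu hv
    simp only [Prod.fst_add, Prod.snd_add, inner_add_right, hp ψ u v h hu hv, hq ψ u v h hu hv]
  smul_mem' := by
    intro c p hp ψ u v h hu hv
    simp only [Prod.smul_fst, Prod.smul_snd, inner_smul_right, hp ψ u v h hu hv]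

/-! ### Thickness in the cylinder -/

/-- The box `z + (0, L_x)^d × (0, L_y)^d`, `z = (a, b) ∈ ℝ^d × ℝ^d`, in the cylinder `ℝ^d × 𝕋^d`,
i.e. the image of the box in `ℝ^d × ℝ^d` under the canonical projection, which is injective on the
box for `L_y ≤ 2π`. -/
def cylinderBox {d : ℕ} (Lx Ly : ℝ) (a b : EuclideanSpace ℝ (Fin d)) : Set (Cylinder d) :=
  (fun z : EuclideanSpace ℝ (Fin d) × EuclideanSpace ℝ (Fin d) => (z.1, toTorus z.2)) ''
    {z | (∀ i, z.1 i ∈ Ioo (a i) (a i + Lx)) ∧ (∀ i, z.2 i ∈ Ioo (b i) (b i + Ly))}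

/-- `ω` is `(θ, L_x, L_y)`-thick in `ℝ^d × 𝕋^d`. -/
structure IsThickWith {d : ℕ} (ω : Set (Cylinder d)) (θ Lx Ly : ℝ) : Prop where
  theta_mem : θ ∈ Ioc (0 : ℝ) 1
  Lx_pos : 0 < Lx
  Ly_mem : Ly ∈ Ioc (0 : ℝ) (2 * Real.pi)
  le_volume : ∀ a b : EuclideanSpace ℝ (Fin d),
    ENNReal.ofReal (θ * Lx ^ d * Ly ^ d) ≤ volume (ω ∩ cylinderBox Lx Ly a b)

/-- `ω` is thick in `ℝ^d × 𝕋^d`, i.e. `(θ, L_x, L_y)`-thick for some parameters. -/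
def IsThick {d : ℕ} (ω : Set (Cylinder d)) : Prop :=
  ∃ θ Lx Ly : ℝ, IsThickWith ω θ Lx Ly

end Grushin

end

/-! Functions `f(x, y) = g(x)` that do not depend on `y` satisfy `Δ_γ f = Δ_x g`, so the degenerate
weight is invisible to them. If `g` has its Fourier transform supported in `{4π²|ξ|² ≤ lam}`, then so
do its translates, and the corresponding `f` lie in `𝓔_lam(-Δ_γ)`. The spectral inequality for all
translates of a single such `g` says that every tube `Q × 𝕋^d` over a large cube `Q ⊂ ℝ^d`, which
carries all but a small part of the mass of the translate of `|g|²` to its centre, meets `ω` in a set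
of measure bounded below, as `g` is bounded. This is thickness with `L_y = 2π`.

Membership in `𝓔_lam(-Δ_γ)` is obtained without the spectral theorem
(`mem_spectralSubspace_of_norm_le`): for any spectral measure `E` of `A`,
`t ‖E((t, ∞)) f‖ ≤ ‖E((t, ∞)) A f‖`, so a vector with `‖Aⁿ f‖ ≤ C lamⁿ` has no component above `lam`.
For the Schwartz functions `g` above, this growth is Plancherel's theorem (`exists_bandlimited`).
That the maximal operator acts on `f` as `-Δ_x g` (`mem_negGrushinGraph`) is an integration by parts
against test functions (`IsTestFunction.integral_grushin_mul`), which rests on the translation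
invariance of the measure of the cylinder. -/

noncomputable section

namespace Grushin

open MeasureTheory Set

/-! ### Projection-valued measures and their operators -/

namespace ProjValuedMeasure

variable {H : Type*} [NormedAddCommGroup H] [InnerProductSpace ℂ H] [CompleteSpace H]

theorem proj_union (E : ProjValuedMeasure H) {S T : Set ℝ} (hS : MeasurableSet S)
    (hT : MeasurableSet T) (hST : Disjoint S T) (f : H) :
    E.proj (S ∪ T) f = E.proj S f + E.proj T f := by
  have h := E.hasSum_iUnion (fun n => if n = 0 then S else if n = 1 then T else ∅)
    (fun n => by split_ifs <;> simp [hS, hT])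
    (fun m n hmn => by
      dsimp only
      split_ifs <;> simp_all [disjoint_comm]) f
  have hU : (⋃ n : ℕ, if n = 0 then S else if n = 1 then T else ∅) = S ∪ T := by
    ext x
    simp only [mem_iUnion, mem_union]
    constructor
    · rintro ⟨n, hn⟩
      split_ifs at hn <;> simp_all
    · rintro (hx | hx)
      · exact ⟨0, by simpa using hx⟩
      · exact ⟨1, by simpa using hx⟩
  rw [hU] at h
  refine h.unique ?_
  have h2 := hasSum_sum_of_ne_finset_zero (L := .unconditional ℕ)
    (s := Finset.range 2)
    (f := fun n : ℕ => E.proj (if n = 0 then S else if n = 1 then T else ∅) f) (fun n hn => by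
      have h0 : n ≠ 0 := by rintro rfl; simp at hn
      have h1 : n ≠ 1 := by rintro rfl; simp at hn
      simp [h0, h1, E.proj_empty])
  simpa [Finset.sum_range_succ] using h2

theorem proj_add_proj_compl (E : ProjValuedMeasure H) {B : Set ℝ} (hB : MeasurableSet B) (f : H) :
    E.proj B f + E.proj Bᶜ f = f := by
  rw [← E.proj_union hB hB.compl disjoint_compl_right, union_compl_self, E.proj_univ]
  rfl

theorem proj_proj_self (E : ProjValuedMeasure H) {B : Set ℝ} (hB : MeasurableSet B) (f : H) :
    E.proj B (E.proj B f) = E.proj B f :=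
  DFunLike.congr_fun (E.isStarProjection B hB).isIdempotentElem.eq f

theorem inner_proj_left (E : ProjValuedMeasure H) {B : Set ℝ} (hB : MeasurableSet B) (f g : H) :
    inner ℂ (E.proj B f) g = inner ℂ f (E.proj B g) := by
  have ha : ContinuousLinearMap.adjoint (E.proj B) = E.proj B :=
    (E.isStarProjection B hB).isSelfAdjoint
  rw [← ContinuousLinearMap.adjoint_inner_right, ha]

theorem norm_proj_le (E : ProjValuedMeasure H) {B : Set ℝ} (hB : MeasurableSet B) (f : H) :
    ‖E.proj B f‖ ≤ ‖f‖ := by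
  have h1 : ‖E.proj B f‖ ^ 2 ≤ ‖f‖ * ‖E.proj B f‖ :=
    (E.norm_sq_proj hB f).le.trans (re_inner_le_norm _ _)
  rcases (norm_nonneg (E.proj B f)).eq_or_lt with h0 | h0
  · rw [← h0]; exact norm_nonneg f
  · nlinarith

/-- Projections attached to disjoint Borel sets annihilate each other: for `u = E(T) f`,
`‖E(S ∪ T) u‖² = ‖E(S) u‖² + ‖u‖²` cannot exceed `‖u‖²`. -/
theorem proj_proj_of_disjoint (E : ProjValuedMeasure H) {S T : Set ℝ} (hS : MeasurableSet S)
    (hT : MeasurableSet T) (hST : Disjoint S T) (f : H) :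
    E.proj S (E.proj T f) = 0 := by
  set u := E.proj T f with hu
  have h1 := E.norm_sq_proj (hS.union hT) u
  rw [E.proj_union hS hT hST, inner_add_right, map_add, ← E.norm_sq_proj hS,
    ← E.norm_sq_proj hT, ← E.proj_union hS hT hST] at h1
  have h2 : E.proj T u = u := E.proj_proj_self hT f
  rw [h2] at h1
  have h3 := E.norm_proj_le (hS.union hT) u
  have h4 : ‖E.proj S u‖ ^ 2 ≤ 0 := by nlinarith [norm_nonneg u, norm_nonneg (E.proj (S ∪ T) u)]
  exact norm_eq_zero.1 (pow_eq_zero_iff two_ne_zero |>.1 (le_antisymm h4 (by positivity)))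

theorem proj_proj (E : ProjValuedMeasure H) {S B : Set ℝ} (hS : MeasurableSet S)
    (hB : MeasurableSet B) (f : H) :
    E.proj S (E.proj B f) = E.proj (S ∩ B) f := by
  have hd : Disjoint (S ∩ B) (S \ B) := disjoint_sdiff_inter.symm
  have hd' : Disjoint (S \ B) B := disjoint_sdiff_left
  have hd'' : Disjoint (S ∩ B) Bᶜ := disjoint_compl_right.mono_left inter_subset_right
  conv_lhs => rw [← inter_union_sdiff S B, E.proj_union (hS.inter hB) (hS.diff hB) hd,
    E.proj_proj_of_disjoint (hS.diff hB) hB hd', add_zero]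
  conv_rhs => rw [← E.proj_add_proj_compl hB f, map_add,
    E.proj_proj_of_disjoint (hS.inter hB) hB.compl hd'', add_zero]

theorem scalarMeasure_proj (E : ProjValuedMeasure H) {B : Set ℝ} (hB : MeasurableSet B) (f : H) :
    E.scalarMeasure (E.proj B f) = (E.scalarMeasure f).restrict B := by
  ext S hS
  rw [E.scalarMeasure_apply _ hS, Measure.restrict_apply hS, E.scalarMeasure_apply _ (hS.inter hB),
    E.proj_proj hS hB]

theorem scalarMeasure_univ (E : ProjValuedMeasure H) (f : H) :
    E.scalarMeasure f univ = ENNReal.ofReal (‖f‖ ^ 2) := by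
  rw [E.scalarMeasure_apply _ MeasurableSet.univ, E.proj_univ]
  rfl

instance (E : ProjValuedMeasure H) (f : H) : IsFiniteMeasure (E.scalarMeasure f) :=
  ⟨by rw [E.scalarMeasure_univ]; exact ENNReal.ofReal_lt_top⟩

namespace IsSpectralMeasureOf

variable {E : ProjValuedMeasure H} {A : Submodule ℂ (H × H)}

theorem integrable_id (hE : E.IsSpectralMeasureOf A) {f g : H} (hf : (f, g) ∈ A) :
    Integrable (fun t : ℝ => t) (E.scalarMeasure f) := by
  have h := (hE.mem_domain_iff f).1 ⟨g, hf⟩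
  have h2 : Integrable (fun t : ℝ => t ^ 2) (E.scalarMeasure f) := by
    refine ⟨by fun_prop, ?_⟩
    rw [hasFiniteIntegral_iff_ofReal (ae_of_all _ fun t => sq_nonneg t)]
    exact h
  refine (h2.add (integrable_const (1 : ℝ))).mono' (by fun_prop) (ae_of_all _ fun t => ?_)
  simp only [Real.norm_eq_abs, Pi.add_apply]
  nlinarith [sq_abs t, abs_nonneg t, sq_nonneg (|t| - 1)]

theorem exists_proj_mem (hE : E.IsSpectralMeasureOf A) {B : Set ℝ} (hB : MeasurableSet B)
    {f g : H} (hf : (f, g) ∈ A) : ∃ k, (E.proj B f, k) ∈ A := by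
  rw [hE.mem_domain_iff, E.scalarMeasure_proj hB]
  exact (lintegral_mono' Measure.restrict_le_self le_rfl).trans_lt
    ((hE.mem_domain_iff f).1 ⟨g, hf⟩)

/-- The operator has no matrix elements between the ranges of `E(B)` and `E(Bᶜ)`: there the
quadratic form is additive, and polarization applies. -/
theorem inner_eq_zero (hE : E.IsSpectralMeasureOf A) {B : Set ℝ} (hB : MeasurableSet B)
    {k v g h : H} (hk : (k, g) ∈ A) (hv : (v, h) ∈ A) (hkB : E.proj B k = k)
    (hvB : E.proj Bᶜ v = v) : inner ℂ k h = 0 := by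
  have key : ∀ c : ℂ, inner ℂ k (c • h) + inner ℂ (c • v) g = 0 := by
    intro c
    have hcv : (c • v, c • h) ∈ A := A.smul_mem c hv
    have hw : (k + c • v, g + c • h) ∈ A := A.add_mem hk hcv
    have hBw : E.proj B (k + c • v) = k := by
      rw [map_add, map_smul, hkB, ← hvB,
        E.proj_proj_of_disjoint hB hB.compl disjoint_compl_right, smul_zero, add_zero]
    have hBw' : E.proj Bᶜ (k + c • v) = c • v := by
      rw [map_add, map_smul, hvB, ← hkB,
        E.proj_proj_of_disjoint hB.compl hB disjoint_compl_left, zero_add]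
    have hm : E.scalarMeasure (k + c • v) = E.scalarMeasure k + E.scalarMeasure (c • v) := by
      have hk' := E.scalarMeasure_proj hB (k + c • v)
      have hv' := E.scalarMeasure_proj hB.compl (k + c • v)
      rw [hBw] at hk'
      rw [hBw'] at hv'
      rw [hk', hv', Measure.restrict_add_restrict_compl hB]
    have h1 := hE.inner_eq _ _ hw
    rw [hm, integral_add_measure (hE.integrable_id hk) (hE.integrable_id hcv), Complex.ofReal_add,
      ← hE.inner_eq _ _ hk, ← hE.inner_eq _ _ hcv, inner_add_left, inner_add_right,
      inner_add_right] at h1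
    linear_combination h1
  have h1 := key 1
  have h2 := key Complex.I
  simp only [one_smul, inner_smul_left, inner_smul_right, Complex.conj_I] at h1 h2
  have h3 : Complex.I * (inner ℂ k h - inner ℂ v g) = 0 := by linear_combination h2
  have h4 := (mul_eq_zero.1 h3).resolve_left Complex.I_ne_zero
  linear_combination (h1 + h4) / 2

/-- Above the spectral value `t`, the operator expands norms by at least the factor `t`. -/
theorem mul_norm_proj_le (hE : E.IsSpectralMeasureOf A) (t : ℝ) {f g : H} (hf : (f, g) ∈ A) :
    t * ‖E.proj (Ioi t) f‖ ≤ ‖E.proj (Ioi t) g‖ := by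
  have hB : MeasurableSet (Ioi t) := measurableSet_Ioi
  set k := E.proj (Ioi t) f with hk
  obtain ⟨a, ha⟩ := hE.exists_proj_mem hB hf
  have hv : (E.proj (Ioi t)ᶜ f, g - a) ∈ A := by
    have := A.sub_mem hf ha
    rwa [Prod.mk_sub_mk, ← hk, sub_eq_of_eq_add' (E.proj_add_proj_compl hB f).symm] at this
  have h0 := hE.inner_eq_zero hB ha hv (E.proj_proj_self hB f) (E.proj_proj_self hB.compl f)
  rw [← hk, inner_sub_right, sub_eq_zero] at h0
  have h1 : inner ℂ k g = ((∫ s, s ∂(E.scalarMeasure k) : ℝ) : ℂ) := by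
    rw [h0]; exact hE.inner_eq _ _ ha
  have h2 : t * ‖k‖ ^ 2 ≤ ∫ s, s ∂(E.scalarMeasure k) := by
    have : ∫ _, t ∂(E.scalarMeasure k) = t * ‖k‖ ^ 2 := by
      rw [integral_const, measureReal_def, E.scalarMeasure_univ,
        ENNReal.toReal_ofReal (by positivity), smul_eq_mul, mul_comm]
    rw [← this]
    refine integral_mono_ae (integrable_const _) (hE.integrable_id ha) ?_
    rw [hk, E.scalarMeasure_proj hB]
    filter_upwards [ae_restrict_mem hB] with s hs using le_of_lt hs
  have h3 : inner ℂ k g = inner ℂ k (E.proj (Ioi t) g) := by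
    rw [← E.inner_proj_left hB, hk, E.proj_proj_self hB]
  have h4 : ∫ s, s ∂(E.scalarMeasure k) ≤ ‖k‖ * ‖E.proj (Ioi t) g‖ := by
    have := re_inner_le_norm (𝕜 := ℂ) k (E.proj (Ioi t) g)
    rwa [← h3, h1, RCLike.re_to_complex, Complex.ofReal_re] at this
  rcases (norm_nonneg k).eq_or_lt with h | h
  · rw [← h, mul_zero]; exact norm_nonneg _
  · nlinarith

end IsSpectralMeasureOf

end ProjValuedMeasure

/-- A vector whose iterates under `A` grow at most like `lamⁿ` lies in `𝓔_lam(A)`: a component above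
a spectral value `t > lam` would grow at least like `tⁿ`. -/
theorem mem_spectralSubspace_of_norm_le {H : Type*} [NormedAddCommGroup H] [InnerProductSpace ℂ H]
    [CompleteSpace H] {A : Submodule ℂ (H × H)} {lam : ℝ} (hlam : 0 < lam) {u : ℕ → H}
    (hu : ∀ n, (u n, u (n + 1)) ∈ A) {C : ℝ} (hC : ∀ n, ‖u n‖ ≤ C * lam ^ n) :
    u 0 ∈ spectralSubspace A lam := by
  simp only [spectralSubspace, Submodule.mem_iInf]
  intro E hE
  have hgt : ∀ t, lam < t → E.proj (Ioi t) (u 0) = 0 := by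
    intro t ht
    have ht0 : 0 < t := hlam.trans ht
    have h1 : ∀ n, t ^ n * ‖E.proj (Ioi t) (u 0)‖ ≤ C * lam ^ n := by
      intro n
      refine le_trans ?_ ((E.norm_proj_le (measurableSet_Ioi (a := t)) (u n)).trans (hC n))
      induction n with
      | zero => simp
      | succ n ih =>
        calc t ^ (n + 1) * ‖E.proj (Ioi t) (u 0)‖
            = t * (t ^ n * ‖E.proj (Ioi t) (u 0)‖) := by ring
          _ ≤ t * ‖E.proj (Ioi t) (u n)‖ := by gcongr
          _ ≤ _ := hE.mul_norm_proj_le t (hu n)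
    have h2 : ∀ n, ‖E.proj (Ioi t) (u 0)‖ ≤ C * (lam / t) ^ n := by
      intro n
      rw [div_pow, ← mul_div_assoc, le_div_iff₀ (by positivity), mul_comm]
      exact h1 n
    have h3 : Filter.Tendsto (fun n => C * (lam / t) ^ n) Filter.atTop (nhds (C * 0)) :=
      (tendsto_pow_atTop_nhds_zero_of_lt_one (by positivity)
        ((div_lt_one ht0).2 ht)).const_mul C
    rw [mul_zero] at h3
    exact norm_le_zero_iff.1 (ge_of_tendsto' h3 h2)
  have h0 : E.proj (Ioi lam) (u 0) = 0 := by
    obtain ⟨s, -, hs, hs'⟩ := exists_seq_strictAnti_tendsto lam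
    have hU : Ioi lam = ⋃ n, Ioi (s n) := by
      ext x
      simp only [mem_Ioi, mem_iUnion]
      refine ⟨fun hx => (hs'.eventually_lt_const hx).exists, ?_⟩
      rintro ⟨n, hn⟩
      exact (hs n).trans hn
    have hm : E.scalarMeasure (u 0) (Ioi lam) = 0 := by
      rw [hU, measure_iUnion_null_iff]
      intro n
      rw [E.scalarMeasure_apply _ measurableSet_Ioi, hgt _ (hs n)]
      simp
    rw [E.scalarMeasure_apply _ measurableSet_Ioi, ENNReal.ofReal_eq_zero] at hm
    exact norm_eq_zero.1 (pow_eq_zero_iff two_ne_zero |>.1 (le_antisymm hm (by positivity)))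
  refine ⟨u 0, ?_⟩
  have := E.proj_add_proj_compl (measurableSet_Iic (a := lam)) (u 0)
  rwa [compl_Iic, h0, add_zero] at this

/-! ### Smooth functions on the cylinder and symmetry of `Δ_γ` -/

/-- The universal cover `ℝ^d × ℝ^d` of the cylinder. -/
abbrev Cover (d : ℕ) : Type := EuclideanSpace ℝ (Fin d) × EuclideanSpace ℝ (Fin d)

/-- The canonical projection `ℝ^d × ℝ^d → ℝ^d × 𝕋^d`. -/
def coverMap {d : ℕ} (p : Cover d) : Cylinder d := (p.1, toTorus p.2)

variable {d : ℕ}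

theorem toTorus_add (v w : EuclideanSpace ℝ (Fin d)) :
    toTorus (v + w) = toTorus v + toTorus w := by
  ext i
  simp [toTorus]

theorem coverMap_add (p q : Cover d) : coverMap (p + q) = coverMap p + coverMap q := by
  simp [coverMap, toTorus_add]

theorem toTorus_zero : toTorus (0 : EuclideanSpace ℝ (Fin d)) = 0 := by
  ext i
  simp [toTorus]

theorem coverMap_zero : coverMap (0 : Cover d) = 0 := by
  simp [coverMap, toTorus_zero]

theorem isOpenQuotientMap_toTorus :
    IsOpenQuotientMap (toTorus : EuclideanSpace ℝ (Fin d) → Torus d) :=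
  (IsOpenQuotientMap.piMap (fun _ : Fin d => QuotientAddGroup.isOpenQuotientMap_mk)).comp
    (EuclideanSpace.equiv (Fin d) ℝ).toHomeomorph.isOpenQuotientMap

theorem isOpenQuotientMap_coverMap : IsOpenQuotientMap (coverMap : Cover d → Cylinder d) :=
  IsOpenQuotientMap.id.prodMap isOpenQuotientMap_toTorus

/-- Smooth functions on the cylinder, tested on the universal cover. -/
def IsSmooth (f : Cylinder d → ℂ) : Prop := ContDiff ℝ (⊤ : ℕ∞) (f ∘ coverMap)

theorem IsSmooth.continuous {f : Cylinder d → ℂ} (hf : IsSmooth f) : Continuous f :=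
  isOpenQuotientMap_coverMap.continuous_comp_iff.1 (ContDiff.continuous hf)

theorem IsSmooth.mul {f g : Cylinder d → ℂ} (hf : IsSmooth f) (hg : IsSmooth g) :
    IsSmooth (f * g) := ContDiff.mul hf hg

theorem IsTestFunction.isSmooth {ψ : Cylinder d → ℂ} (hψ : IsTestFunction ψ) : IsSmooth ψ :=
  hψ.smooth

theorem IsTestFunction.mul {ψ f : Cylinder d → ℂ} (hψ : IsTestFunction ψ) (hf : IsSmooth f) :
    IsTestFunction (ψ * f) :=
  ⟨hψ.isSmooth.mul hf, hψ.compactSupport.mul_right⟩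

theorem IsTestFunction.integrable {ψ : Cylinder d → ℂ} (hψ : IsTestFunction ψ) :
    Integrable ψ :=
  hψ.isSmooth.continuous.integrable_of_hasCompactSupport hψ.compactSupport

/-- The derivative of `f` at the point `z` of the cylinder in the direction `w`. -/
def dirDeriv (w : Cover d) (f : Cylinder d → ℂ) (z : Cylinder d) : ℂ :=
  fderiv ℝ (fun p => f (z + coverMap p)) 0 w

theorem dirDeriv_coverMap (w : Cover d) (f : Cylinder d → ℂ) (p : Cover d) :
    dirDeriv w f (coverMap p) = fderiv ℝ (f ∘ coverMap) p w := by
  have h : (fun q => f (coverMap p + coverMap q)) = fun q => (f ∘ coverMap) (p + q) := by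
    ext q
    rw [Function.comp_apply, coverMap_add]
  rw [dirDeriv, h, fderiv_comp_add_left, add_zero]

protected theorem IsSmooth.dirDeriv {f : Cylinder d → ℂ} (hf : IsSmooth f) (w : Cover d) :
    IsSmooth (dirDeriv w f) := by
  have h : Grushin.dirDeriv w f ∘ coverMap = fun p => fderiv ℝ (f ∘ coverMap) p w :=
    funext fun p => dirDeriv_coverMap w f p
  rw [IsSmooth, h]
  exact (ContDiff.fderiv_right (m := (⊤ : ℕ∞)) hf (by simp)).clm_apply contDiff_const

theorem dirDeriv_dirDeriv_coverMap (w : Cover d) (f : Cylinder d → ℂ) (p : Cover d) :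
    dirDeriv w (dirDeriv w f) (coverMap p) =
      fderiv ℝ (fun q => fderiv ℝ (f ∘ coverMap) q w) p w := by
  rw [dirDeriv_coverMap]
  congr 2
  exact funext fun p => dirDeriv_coverMap w f p

theorem IsSmooth.dirDeriv_mul {f g : Cylinder d → ℂ} (hf : IsSmooth f) (hg : IsSmooth g)
    (w : Cover d) : Grushin.dirDeriv w (f * g) =
      Grushin.dirDeriv w f * g + f * Grushin.dirDeriv w g := by
  ext z
  obtain ⟨p, rfl⟩ := isOpenQuotientMap_coverMap.surjective z
  have h : (f * g) ∘ coverMap = (f ∘ coverMap) * (g ∘ coverMap) := rfl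
  have h1 : DifferentiableAt ℝ (f ∘ coverMap) p := ContDiff.differentiable hf (by simp) p
  have h2 : DifferentiableAt ℝ (g ∘ coverMap) p := ContDiff.differentiable hg (by simp) p
  simp only [Pi.add_apply, Pi.mul_apply, dirDeriv_coverMap]
  rw [h, fderiv_mul h1 h2]
  simp only [add_apply, smul_apply, smul_eq_mul,
    Function.comp_apply]
  ring

protected theorem IsTestFunction.dirDeriv {ψ : Cylinder d → ℂ} (hψ : IsTestFunction ψ) (w : Cover d) :
    IsTestFunction (dirDeriv w ψ) := by
  refine ⟨hψ.isSmooth.dirDeriv w, ?_⟩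
  refine hψ.compactSupport.mono' fun z hz => ?_
  by_contra hz'
  refine hz ?_
  have h1 : ψ =ᶠ[nhds z] 0 := notMem_tsupport_iff_eventuallyEq.1 hz'
  have h2 : Filter.Tendsto (fun p : Cover d => z + coverMap p) (nhds 0) (nhds z) := by
    have hc : Continuous (fun p : Cover d => z + coverMap p) :=
      continuous_const.add isOpenQuotientMap_coverMap.continuous
    simpa [coverMap_zero] using hc.tendsto 0
  have h3 : (fun p : Cover d => ψ (z + coverMap p)) =ᶠ[nhds 0] fun _ => 0 := h2.eventually h1
  rw [Grushin.dirDeriv, h3.fderiv_eq]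
  simp

theorem IsSmooth.hasDerivAt {f : Cylinder d → ℂ} (hf : IsSmooth f) (w : Cover d)
    (z : Cylinder d) (t : ℝ) :
    HasDerivAt (fun s : ℝ => f (z + coverMap (s • w)))
      (Grushin.dirDeriv w f (z + coverMap (t • w))) t := by
  obtain ⟨p, rfl⟩ := isOpenQuotientMap_coverMap.surjective z
  simp only [← coverMap_add, dirDeriv_coverMap]
  have h1 : HasFDerivAt (f ∘ coverMap) (fderiv ℝ (f ∘ coverMap) (p + t • w)) (p + t • w) :=
    (ContDiff.differentiable hf (by simp) _).hasFDerivAt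
  have h2 : HasDerivAt (fun s : ℝ => p + s • w) w t := by
    simpa using ((hasDerivAt_id t).smul_const w).const_add p
  exact h1.comp_hasDerivAt t h2

instance : (volume : Measure (Cylinder d)).IsAddRightInvariant :=
  Measure.prod.instIsAddRightInvariant (μ := (volume : Measure (EuclideanSpace ℝ (Fin d))))
    (ν := (volume : Measure (Torus d)))

theorem integral_translate {F : Type*} [NormedAddCommGroup F] [NormedSpace ℝ F]
    (f : Cylinder d → F) (q : Cylinder d) : ∫ z, f (z + q) = ∫ z, f z :=
  integral_add_right_eq_self f q

theorem integrable_translate {F : Type*} [NormedAddCommGroup F]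
    {f : Cylinder d → F} (hf : Integrable f) (q : Cylinder d) : Integrable fun z => f (z + q) :=
  hf.comp_add_right q

/-- The integral of a derivative vanishes, by translation invariance of the measure: integrating
`∂_w ψ` along segments gives `∫ ∂_w ψ = ∫ (ψ(z + w) - ψ(z)) dz`. -/
theorem IsTestFunction.integral_dirDeriv {ψ : Cylinder d → ℂ} (hψ : IsTestFunction ψ)
    (w : Cover d) : ∫ z, dirDeriv w ψ z = 0 := by
  have hD := hψ.dirDeriv w
  have hcov : Continuous (coverMap : Cover d → Cylinder d) := isOpenQuotientMap_coverMap.continuous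
  have h1 : ∀ z : Cylinder d, ∫ t in Ioc (0 : ℝ) 1, dirDeriv w ψ (z + coverMap (t • w)) =
      ψ (z + coverMap w) - ψ z := by
    intro z
    rw [← intervalIntegral.integral_of_le zero_le_one, intervalIntegral.integral_eq_sub_of_hasDerivAt
      (fun t _ => hψ.isSmooth.hasDerivAt w z t)]
    · simp [coverMap_zero]
    · have := hD.isSmooth.continuous
      exact Continuous.intervalIntegrable (by fun_prop) _ _
  have hint : Integrable (Function.uncurry fun (z : Cylinder d) (t : ℝ) =>
      dirDeriv w ψ (z + coverMap (t • w)))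
      ((volume : Measure (Cylinder d)).prod (volume.restrict (Ioc (0 : ℝ) 1))) := by
    have hc : Continuous (Function.uncurry fun (z : Cylinder d) (t : ℝ) =>
        dirDeriv w ψ (z + coverMap (t • w))) := by
      have := hD.isSmooth.continuous
      unfold Function.uncurry
      fun_prop
    rw [integrable_prod_iff' hc.aestronglyMeasurable]
    have hi (t : ℝ) : Integrable fun z : Cylinder d => dirDeriv w ψ (z + coverMap (t • w)) :=
      integrable_translate hD.integrable (coverMap (t • w))
    refine ⟨ae_of_all _ hi, ?_⟩
    have (t : ℝ) : ∫ z : Cylinder d, ‖dirDeriv w ψ (z + coverMap (t • w))‖ =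
        ∫ z : Cylinder d, ‖dirDeriv w ψ z‖ :=
      integral_translate (fun z => ‖dirDeriv w ψ z‖) (coverMap (t • w))
    simp only [Function.uncurry, this]
    exact integrable_const _
  have h2 := integral_integral_swap hint
  simp only [h1, integral_translate (dirDeriv w ψ)] at h2
  rw [integral_sub (integrable_translate hψ.integrable (coverMap w)) hψ.integrable,
    integral_translate ψ, sub_self] at h2
  simpa using h2.symm

theorem IsTestFunction.integral_dirDeriv_mul {ψ f : Cylinder d → ℂ} (hψ : IsTestFunction ψ)
    (hf : IsSmooth f) (w : Cover d) :
    ∫ z, dirDeriv w ψ z * f z = -∫ z, ψ z * dirDeriv w f z := by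
  have h := (hψ.mul hf).integral_dirDeriv w
  rw [hψ.isSmooth.dirDeriv_mul hf w] at h
  have h2 := integral_add (((hψ.dirDeriv w).mul hf).integrable)
    ((hψ.mul (hf.dirDeriv w)).integrable)
  exact eq_neg_of_add_eq_zero_left (h2.symm.trans h)

theorem IsTestFunction.integral_dirDeriv_dirDeriv_mul {ψ f : Cylinder d → ℂ}
    (hψ : IsTestFunction ψ) (hf : IsSmooth f) (w : Cover d) :
    ∫ z, dirDeriv w (dirDeriv w ψ) z * f z = ∫ z, ψ z * dirDeriv w (dirDeriv w f) z := by
  rw [(hψ.dirDeriv w).integral_dirDeriv_mul hf w, hψ.integral_dirDeriv_mul (hf.dirDeriv w) w,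
    neg_neg]

/-- The Laplacian along an affine map, in terms of second derivatives on the target. It serves both
for the two partial Laplacians on the universal cover and for translations. -/
theorem laplacian_comp_affine {W : Type*} [NormedAddCommGroup W] [NormedSpace ℝ W] {G : W → ℂ}
    (hG : ContDiff ℝ (⊤ : ℕ∞) G) (a : W) (L : EuclideanSpace ℝ (Fin d) →L[ℝ] W)
    (x : EuclideanSpace ℝ (Fin d)) :
    Laplacian.laplacian (fun x => G (a + L x)) x =
      ∑ i, fderiv ℝ (fun q => fderiv ℝ G q (L (EuclideanSpace.basisFun (Fin d) ℝ i)))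
        (a + L x) (L (EuclideanSpace.basisFun (Fin d) ℝ i)) := by
  have hchain : ∀ {F : W → ℂ} (_ : Differentiable ℝ F) (x e : EuclideanSpace ℝ (Fin d)),
      fderiv ℝ (fun x => F (a + L x)) x e = fderiv ℝ F (a + L x) (L e) := by
    intro F hF x e
    have h := (hF (a + L x)).hasFDerivAt.comp x (L.hasFDerivAt.const_add a)
    have h' : HasFDerivAt (fun x => F (a + L x)) ((fderiv ℝ F (a + L x)).comp L) x := h
    rw [h'.fderiv]
    rfl
  have hG1 : Differentiable ℝ G := hG.differentiable (by simp)
  have hsm : ContDiff ℝ (⊤ : ℕ∞) (fun x => G (a + L x)) := hG.comp (by fun_prop)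
  rw [InnerProductSpace.laplacian_eq_iteratedFDeriv_orthonormalBasis _
    (EuclideanSpace.basisFun (Fin d) ℝ)]
  refine Finset.sum_congr rfl fun i _ => ?_
  set e := EuclideanSpace.basisFun (Fin d) ℝ i
  rw [iteratedFDeriv_two_apply]
  simp only [Matrix.cons_val_zero, Matrix.cons_val_one]
  have hd : DifferentiableAt ℝ (fderiv ℝ (fun x => G (a + L x))) x :=
    (hsm.fderiv_right (m := (⊤ : ℕ∞)) (by simp)).differentiable (by simp) x
  have h1 : fderiv ℝ (fderiv ℝ (fun x => G (a + L x))) x e e =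
      fderiv ℝ (fun x => fderiv ℝ (fun x => G (a + L x)) x e) x e := by
    rw [fderiv_clm_apply hd (by fun_prop)]
    simp
  rw [h1]
  simp only [hchain hG1]
  refine hchain (F := fun q => fderiv ℝ G q (L e)) ?_ x e
  exact ((hG.fderiv_right (m := (⊤ : ℕ∞)) (by simp)).clm_apply contDiff_const).differentiable (by simp)

theorem IsSmooth.grushin_eq {f : Cylinder d → ℂ} (hf : IsSmooth f) (γ : ℕ) (z : Cylinder d) :
    grushin γ f z =
      ∑ i, Grushin.dirDeriv (EuclideanSpace.basisFun (Fin d) ℝ i, 0)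
        (Grushin.dirDeriv (EuclideanSpace.basisFun (Fin d) ℝ i, 0) f) z +
      ((‖z.1‖ ^ (2 * γ) : ℝ) : ℂ) * ∑ i, Grushin.dirDeriv (0, EuclideanSpace.basisFun (Fin d) ℝ i)
        (Grushin.dirDeriv (0, EuclideanSpace.basisFun (Fin d) ℝ i) f) z := by
  obtain ⟨p, rfl⟩ := isOpenQuotientMap_coverMap.surjective z
  have h1 := laplacian_comp_affine hf (0, p.2) (ContinuousLinearMap.inl ℝ _ _) p.1
  have h2 := laplacian_comp_affine hf p (ContinuousLinearMap.inr ℝ _ _) 0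
  simp only [dirDeriv_dirDeriv_coverMap, grushin]
  simp only [coverMap, ContinuousLinearMap.inl_apply, ContinuousLinearMap.inr_apply, Prod.mk_add_mk,
    zero_add, add_zero, Function.comp_def, Prod.mk.eta, Prod.fst_add, Prod.snd_add, toTorus_add,
    Prod.mk_zero_zero] at h1 h2 ⊢
  rw [h1, h2]

theorem isSmooth_comp_fst {g : EuclideanSpace ℝ (Fin d) → ℂ} (hg : ContDiff ℝ (⊤ : ℕ∞) g) :
    IsSmooth (fun z : Cylinder d => g z.1) :=
  hg.comp contDiff_fst

theorem dirDeriv_comp_fst (g : EuclideanSpace ℝ (Fin d) → ℂ) (w : EuclideanSpace ℝ (Fin d)) :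
    dirDeriv (0, w) (fun z : Cylinder d => g z.1) = 0 := by
  ext z
  rw [dirDeriv, Pi.zero_apply]
  by_cases h : DifferentiableAt ℝ (fun p : Cover d => g (z + coverMap p).1) 0
  · rw [← h.lineDeriv_eq_fderiv]
    simp [lineDeriv, coverMap]
  · rw [fderiv_zero_of_not_differentiableAt h]
    rfl

/-- `Δ_γ` is formally symmetric. The weight `|x|^{2γ}` may be moved onto the test function, as it
is smooth and constant in the directions of the torus. -/
theorem IsTestFunction.integral_grushin_mul {ψ f : Cylinder d → ℂ} (hψ : IsTestFunction ψ)
    (hf : IsSmooth f) (γ : ℕ) : ∫ z, grushin γ ψ z * f z = ∫ z, ψ z * grushin γ f z := by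
  set a : Cylinder d → ℂ := fun z => ((‖z.1‖ ^ (2 * γ) : ℝ) : ℂ) with ha
  have hasm : IsSmooth a := by
    refine isSmooth_comp_fst (g := fun x => ((‖x‖ ^ (2 * γ) : ℝ) : ℂ)) ?_
    simp only [pow_mul]
    exact Complex.ofRealCLM.contDiff.comp ((contDiff_norm_sq ℝ).pow γ)
  have haf : ∀ w : EuclideanSpace ℝ (Fin d), dirDeriv (0, w) (dirDeriv (0, w) (a * f)) =
      a * dirDeriv (0, w) (dirDeriv (0, w) f) := by
    intro w
    have ha0 : dirDeriv (0, w) a = 0 :=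
      dirDeriv_comp_fst (fun x => ((‖x‖ ^ (2 * γ) : ℝ) : ℂ)) w
    rw [hasm.dirDeriv_mul hf, ha0, zero_mul, zero_add, hasm.dirDeriv_mul (hf.dirDeriv _), ha0,
      zero_mul, zero_add]
  let e := EuclideanSpace.basisFun (Fin d) ℝ
  have hl : ∀ z, grushin γ ψ z * f z =
      ∑ i, (dirDeriv (e i, 0) (dirDeriv (e i, 0) ψ) z * f z +
        dirDeriv (0, e i) (dirDeriv (0, e i) ψ) z * (a * f) z) := by
    intro z
    rw [hψ.isSmooth.grushin_eq, Finset.sum_add_distrib, add_mul, Finset.sum_mul, Finset.mul_sum,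
      Finset.sum_mul]
    congr 1
    refine Finset.sum_congr rfl fun i _ => ?_
    simp only [Pi.mul_apply, ha, e]
    ring
  have hr : ∀ z, ψ z * grushin γ f z =
      ∑ i, (ψ z * dirDeriv (e i, 0) (dirDeriv (e i, 0) f) z +
        ψ z * dirDeriv (0, e i) (dirDeriv (0, e i) (a * f)) z) := by
    intro z
    rw [hf.grushin_eq, Finset.sum_add_distrib, mul_add, Finset.mul_sum, Finset.mul_sum,
      Finset.mul_sum]
    congr 1
    refine Finset.sum_congr rfl fun i _ => ?_
    rw [haf]
    simp only [Pi.mul_apply, ha, e]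
  simp only [hl, hr]
  have hi1 : ∀ (w : Cover d) {g : Cylinder d → ℂ}, IsSmooth g →
      Integrable fun z => dirDeriv w (dirDeriv w ψ) z * g z :=
    fun w g hg => (((hψ.dirDeriv w).dirDeriv w).mul hg).integrable
  have hi2 : ∀ (w : Cover d) {g : Cylinder d → ℂ}, IsSmooth g →
      Integrable fun z => ψ z * dirDeriv w (dirDeriv w g) z :=
    fun w g hg => (hψ.mul ((hg.dirDeriv w).dirDeriv w)).integrable
  have haf' := hasm.mul hf
  rw [integral_finsetSum, integral_finsetSum]
  rotate_left
  · exact fun i _ => (hi2 _ hf).add (hi2 _ haf')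
  · exact fun i _ => (hi1 _ hf).add (hi1 _ haf')
  refine Finset.sum_congr rfl fun i _ => ?_
  rw [integral_add (hi1 _ hf) (hi1 _ haf'), integral_add (hi2 _ hf) (hi2 _ haf'),
    hψ.integral_dirDeriv_dirDeriv_mul hf, hψ.integral_dirDeriv_dirDeriv_mul haf']

theorem grushin_comp_fst (γ : ℕ) (g : EuclideanSpace ℝ (Fin d) → ℂ) (z : Cylinder d) :
    grushin γ (fun z : Cylinder d => g z.1) z = Laplacian.laplacian g z.1 := by
  simp [grushin]

/-- A smooth function of `x` alone, not assumed to have compact support, is in the domain of the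
maximal operator as soon as it and its Laplacian have classes in `L²`. -/
theorem mem_negGrushinGraph (γ : ℕ) {g h : EuclideanSpace ℝ (Fin d) → ℂ}
    (hg : ContDiff ℝ (⊤ : ℕ∞) g) (hh : ∀ x, h x = -Laplacian.laplacian g x) {f k : L2 d}
    (hf : f =ᵐ[volume] fun z => g z.1) (hk : k =ᵐ[volume] fun z => h z.1) :
    (f, k) ∈ negGrushinGraph γ d := by
  intro ψ u v hψ hu hv
  set G : Cylinder d → ℂ := fun z => starRingEnd ℂ (g z.1) with hGdef
  have hGs : IsSmooth G :=
    isSmooth_comp_fst (g := fun x => starRingEnd ℂ (g x)) (Complex.conjCLE.contDiff.comp hg)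
  have hΔ : ∀ z, grushin γ G z = starRingEnd ℂ (Laplacian.laplacian g z.1) := by
    intro z
    rw [hGdef, grushin_comp_fst γ (fun x => starRingEnd ℂ (g x))]
    exact congrFun (InnerProductSpace.laplacian_CLE_comp_left (f := g) (l := Complex.conjCLE)) z.1
  have key := hψ.integral_grushin_mul hGs γ
  rw [← inner_conj_symm, ← inner_conj_symm u]
  congr 1
  rw [L2.inner_def, L2.inner_def]
  have h1 : ∫ z, inner ℂ (f z) (v z) = -∫ z, grushin γ ψ z * G z := by
    rw [← integral_neg]
    refine integral_congr_ae ?_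
    filter_upwards [hf, hv] with z h1 h2
    simp only [RCLike.inner_apply, h1, h2, hGdef]
    ring
  have h2 : ∫ z, inner ℂ (k z) (u z) = -∫ z, ψ z * grushin γ G z := by
    rw [← integral_neg]
    refine integral_congr_ae ?_
    filter_upwards [hk, hu] with z h1 h2
    simp only [RCLike.inner_apply, h1, h2, hΔ, hh, map_neg]
    ring
  exact h1.trans ((congrArg Neg.neg key).trans h2.symm)

/-! ### Band-limited functions of `x` -/

open scoped SchwartzMap FourierTransform ENNReal


theorem laplacian_comp_sub {G : EuclideanSpace ℝ (Fin d) → ℂ} (hG : ContDiff ℝ (⊤ : ℕ∞) G)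
    (a x : EuclideanSpace ℝ (Fin d)) :
    Laplacian.laplacian (fun x => G (x - a)) x = Laplacian.laplacian G (x - a) := by
  have h1 := laplacian_comp_affine hG (-a) (ContinuousLinearMap.id ℝ _) x
  have h2 := laplacian_comp_affine hG 0 (ContinuousLinearMap.id ℝ _) (x - a)
  simp only [ContinuousLinearMap.id_apply, zero_add, neg_add_eq_sub] at h1 h2
  exact h1.trans h2.symm

/-- The inverse Fourier transform of a bump function supported in `{4π²|ξ|² ≤ lam}` is a Schwartz
function on which the iterates of `-Δ` grow at most like `lamⁿ` in `L²`. -/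
theorem exists_bandlimited (d : ℕ) {lam : ℝ} (hlam : 0 < lam) :
    ∃ (g : ℕ → 𝓢(EuclideanSpace ℝ (Fin d), ℂ)) (C : ℝ), g 0 ≠ 0 ∧
      (∀ n x, g (n + 1) x = -Laplacian.laplacian (g n : EuclideanSpace ℝ (Fin d) → ℂ) x) ∧
      ∀ n, ‖(g n).toLp 2‖ ≤ C * lam ^ n := by
  have hr : 0 < √lam / (2 * Real.pi) := by positivity
  let b : ContDiffBump (0 : EuclideanSpace ℝ (Fin d)) :=
    ⟨√lam / (2 * Real.pi) / 2, √lam / (2 * Real.pi), by positivity, by linarith⟩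
  have hbc : HasCompactSupport (fun x => (b x : ℂ)) :=
    b.hasCompactSupport.comp_left Complex.ofReal_zero
  have hbs : ContDiff ℝ (⊤ : ℕ∞) (fun x => (b x : ℂ)) :=
    Complex.ofRealCLM.contDiff.comp b.contDiff
  let φ : 𝓢(EuclideanSpace ℝ (Fin d), ℂ) := hbc.toSchwartzMap hbs
  have hφ : ∀ x, φ x = (b x : ℂ) := fun x => rfl
  let g : ℕ → 𝓢(EuclideanSpace ℝ (Fin d), ℂ) := fun n =>
    (fun f => -Laplacian.laplacian f)^[n] (𝓕⁻ φ)
  have hg : ∀ n, g (n + 1) = -Laplacian.laplacian (g n) :=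
    fun n => Function.iterate_succ_apply' _ _ _
  have hF : ∀ n ξ, 𝓕 (g n) ξ = (((2 * Real.pi) ^ 2 * ‖ξ‖ ^ 2) ^ n : ℝ) * φ ξ := by
    intro n
    induction n with
    | zero =>
      intro ξ
      simp [g]
    | succ n ih =>
      intro ξ
      have ht : (fun x : EuclideanSpace ℝ (Fin d) => ‖x‖ ^ 2).HasTemperateGrowth := by fun_prop
      rw [hg, SchwartzMap.laplacian_eq_fourierMultiplierCLM,
        SchwartzMap.fourierMultiplierCLM_apply, neg_smul, neg_neg, FourierTransform.fourier_smul,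
        FourierTransform.fourier_fourierInv_eq, smul_apply,
        SchwartzMap.smulLeftCLM_apply_apply (g := fun x => ‖x‖ ^ 2) ht, ih, pow_succ]
      simp only [Complex.real_smul]
      push_cast
      ring
  refine ⟨g, ‖φ.toLp 2‖, ?_, ?_, ?_⟩
  · intro h0
    have h1 := hF 0 0
    rw [h0] at h1
    have h2 : b 0 = 1 := b.one_of_mem_closedBall (by simp [b.rIn_pos.le])
    simp [hφ, h2] at h1
  · intro n x
    rw [hg, neg_apply, SchwartzMap.laplacian_apply]
  · intro n
    rw [← SchwartzMap.norm_fourier_toL2_eq, mul_comm]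
    refine Lp.norm_le_mul_norm_of_ae_le_mul ?_
    filter_upwards [(𝓕 (g n)).coeFn_toLp 2, φ.coeFn_toLp 2] with ξ h1 h2
    rw [h1, h2, hF, norm_mul, Complex.norm_real, Real.norm_of_nonneg (by positivity)]
    by_cases hξ : φ ξ = 0
    · simp [hξ]
    · have h3 : ξ ∈ Function.support b := by
        intro h
        exact hξ (by rw [hφ, h, Complex.ofReal_zero])
      rw [b.support_eq, mem_ball_zero_iff] at h3
      have h4 : (2 * Real.pi) * ‖ξ‖ ≤ √lam := by
        have : ‖ξ‖ < √lam / (2 * Real.pi) := h3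
        rw [lt_div_iff₀ (by positivity)] at this
        linarith
      have h5 : (2 * Real.pi) ^ 2 * ‖ξ‖ ^ 2 ≤ lam := by
        rw [← mul_pow, ← Real.sq_sqrt hlam.le]
        gcongr
      gcongr

theorem eLpNorm_comp_fst (g : 𝓢(EuclideanSpace ℝ (Fin d), ℂ)) :
    eLpNorm (fun z : Cylinder d => g z.1) 2 volume =
      (volume (univ : Set (Torus d))) ^ (2 : ℝ)⁻¹ * eLpNorm g 2 volume := by
  have h := eLpNorm_map_measure (p := 2) (μ := (volume : Measure (Cylinder d))) (f := Prod.fst)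
    (g := g) g.continuous.aestronglyMeasurable measurable_fst.aemeasurable
  have h2 : (volume : Measure (Cylinder d)).map Prod.fst =
      (volume (univ : Set (Torus d))) • (volume : Measure (EuclideanSpace ℝ (Fin d))) :=
    Measure.map_fst_prod
  rw [h2, eLpNorm_smul_measure_of_ne_top (by simp)] at h
  simpa [Function.comp_def] using h.symm

/-- The class in `L²(ℝ^d × 𝕋^d)` of a Schwartz function of `x`. -/
def lift (g : 𝓢(EuclideanSpace ℝ (Fin d), ℂ)) : L2 d :=
  (((g.memLp 2 volume).comp_fst (volume : Measure (Torus d))) :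
    MemLp (fun z : Cylinder d => g z.1) 2 volume).toLp

theorem coeFn_lift (g : 𝓢(EuclideanSpace ℝ (Fin d), ℂ)) :
    lift g =ᵐ[volume] fun z : Cylinder d => g z.1 := MemLp.coeFn_toLp _

theorem norm_lift (g : 𝓢(EuclideanSpace ℝ (Fin d), ℂ)) :
    ‖lift g‖ = ((volume (univ : Set (Torus d))) ^ (2 : ℝ)⁻¹).toReal * ‖g.toLp 2‖ := by
  rw [Lp.norm_def, eLpNorm_congr_ae (coeFn_lift g), eLpNorm_comp_fst, ENNReal.toReal_mul, SchwartzMap.norm_toLp]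

theorem norm_toLp_compSubConst (g : 𝓢(EuclideanSpace ℝ (Fin d), ℂ))
    (a : EuclideanSpace ℝ (Fin d)) : ‖(g.compSubConstCLM ℂ a).toLp 2‖ = ‖g.toLp 2‖ := by
  rw [SchwartzMap.norm_toLp, SchwartzMap.norm_toLp]
  congr 1
  exact eLpNorm_comp_measurePreserving (g := g) g.continuous.aestronglyMeasurable
    (measurePreserving_sub_right volume a)

/-- Some nonzero Schwartz function of `x` has all its translates in `𝓔_lam(-Δ_γ)`. -/
theorem exists_translates_mem_spectralSubspace (d γ : ℕ) {lam : ℝ} (hlam : 0 < lam) :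
    ∃ g : 𝓢(EuclideanSpace ℝ (Fin d), ℂ), g ≠ 0 ∧
      ∀ a, lift (g.compSubConstCLM ℂ a) ∈ spectralSubspace (negGrushinGraph γ d) lam := by
  obtain ⟨g, C, h0, hΔ, hC⟩ := exists_bandlimited d hlam
  refine ⟨g 0, h0, fun a => ?_⟩
  refine mem_spectralSubspace_of_norm_le hlam (u := fun n => lift ((g n).compSubConstCLM ℂ a))
    (C := ((volume (univ : Set (Torus d))) ^ (2 : ℝ)⁻¹).toReal * C) (fun n => ?_) fun n => ?_
  · refine mem_negGrushinGraph γ (((g n).compSubConstCLM ℂ a).smooth ⊤) (fun x => ?_)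
      (coeFn_lift _) (coeFn_lift _)
    rw [SchwartzMap.compSubConstCLM_apply, hΔ, ← laplacian_comp_sub ((g n).smooth ⊤)]
    rfl
  · rw [norm_lift, norm_toLp_compSubConst, mul_assoc]
    gcongr
    exact hC n

/-! ### Thickness -/

theorem volume_torus_ne_zero : volume (univ : Set (Torus d)) ≠ 0 :=
  isOpen_univ.measure_ne_zero volume univ_nonempty

instance : NullSingletonClass (volume : Measure (AddCircle (2 * Real.pi))) :=
  ⟨fun x => by
    have h := AddCircle.volume_closedBall (T := 2 * Real.pi) (x := x) 0
    rwa [Metric.closedBall_zero, mul_zero, min_eq_right Real.two_pi_pos.le,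
      ENNReal.ofReal_zero] at h⟩

/-- Up to a null set, a box of the full length `2π` in `y` is a tube `Q × 𝕋^d`. -/
theorem measure_inter_tube_le (ω : Set (Cylinder d)) (L : ℝ)
    (a b : EuclideanSpace ℝ (Fin d)) :
    volume (ω ∩ {z : Cylinder d | ∀ i, z.1 i ∈ Ioo (a i) (a i + L)}) ≤
      volume (ω ∩ cylinderBox L (2 * Real.pi) a b) := by
  have hnull : volume {z : Cylinder d | ∃ i, z.2 i = ((b i : ℝ) : AddCircle (2 * Real.pi))} = 0 := by
    have h1 : volume {y : Torus d | ∃ i, y i = ((b i : ℝ) : AddCircle (2 * Real.pi))} = 0 := by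
      rw [ofPred_exists, measure_iUnion_null_iff]
      exact fun i => Measure.pi_hyperplane _ i _
    exact (Measure.quasiMeasurePreserving_snd
      (μ := (volume : Measure (EuclideanSpace ℝ (Fin d)))) (ν := (volume : Measure (Torus d)))
      ).preimage_null h1
  refine (measure_mono (t := (ω ∩ cylinderBox L (2 * Real.pi) a b) ∪
    {z : Cylinder d | ∃ i, z.2 i = ((b i : ℝ) : AddCircle (2 * Real.pi))}) ?_).trans
    ((measure_union_le _ _).trans (by rw [hnull, add_zero]))
  rintro z ⟨hzω, hz⟩
  by_cases hb : ∃ i, z.2 i = ((b i : ℝ) : AddCircle (2 * Real.pi))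
  · exact Or.inr hb
  refine Or.inl ⟨hzω, ?_⟩
  push Not at hb
  refine ⟨(z.1, WithLp.toLp 2 fun i => (AddCircle.equivIco (2 * Real.pi) (b i) (z.2 i) : ℝ)),
    ⟨hz, fun i => ?_⟩, ?_⟩
  · have h := (AddCircle.equivIco (2 * Real.pi) (b i) (z.2 i)).2
    refine ⟨lt_of_le_of_ne h.1 fun h' => hb i ?_, h.2⟩
    have h2 := AddCircle.coe_equivIco (p := 2 * Real.pi) (a := b i) (y := z.2 i)
    rw [← h2]
    exact congrArg _ h'.symm
  · ext i
    · rfl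
    · exact AddCircle.coe_equivIco

theorem eLpNorm_two_sq {α : Type*} [MeasurableSpace α] (μ : Measure α) (f : α → ℂ) :
    eLpNorm f 2 μ ^ 2 = ∫⁻ z, ‖f z‖ₑ ^ 2 ∂μ := by
  rw [eLpNorm_eq_lintegral_rpow_enorm_toReal two_ne_zero ENNReal.ofNat_ne_top,
    ← ENNReal.rpow_natCast, ← ENNReal.rpow_mul]
  simp

theorem lintegral_comp_fst {h : EuclideanSpace ℝ (Fin d) → ℝ≥0∞} (hh : Measurable h) :
    ∫⁻ z : Cylinder d, h z.1 = volume (univ : Set (Torus d)) * ∫⁻ x, h x := by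
  have h2 : (volume : Measure (Cylinder d)).map Prod.fst =
      (volume (univ : Set (Torus d))) • (volume : Measure (EuclideanSpace ℝ (Fin d))) :=
    Measure.map_fst_prod
  rw [← lintegral_map hh measurable_fst, h2, lintegral_smul_measure, smul_eq_mul]

/-- An integrable function is concentrated on a large cube. -/
theorem exists_cube_setLIntegral_compl_le {h : EuclideanSpace ℝ (Fin d) → ℝ≥0∞}
    (hfin : ∫⁻ x, h x ≠ ∞) {ε : ℝ≥0∞} (hε : 0 < ε) :
    ∃ n : ℕ, 0 < n ∧ ∫⁻ x in {x | ∀ i, x i ∈ Ioo (-(n : ℝ)) n}ᶜ, h x < ε := by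
  let Q : ℕ → Set (EuclideanSpace ℝ (Fin d)) := fun n => {x | ∀ i, x i ∈ Ioo (-(n : ℝ)) n}
  have hQ : ∀ n, MeasurableSet (Q n) := by
    intro n
    simp only [Q, ofPred_forall]
    exact MeasurableSet.iInter fun i =>
      (measurable_pi_apply i |>.comp (WithLp.measurable_ofLp _ _)) measurableSet_Ioo
  have hmono : Antitone fun n => (Q n)ᶜ := by
    intro m n hmn
    refine compl_subset_compl.2 fun x hx i => ?_
    have : (m : ℝ) ≤ n := by exact_mod_cast hmn
    exact ⟨by linarith [(hx i).1], by linarith [(hx i).2]⟩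
  have hempty : ⋂ n, (Q n)ᶜ = ∅ := by
    rw [← compl_iUnion, compl_empty_iff, eq_univ_iff_forall]
    intro x
    obtain ⟨n, hn⟩ := exists_nat_gt ‖x‖
    refine mem_iUnion.2 ⟨n, fun i => ?_⟩
    have := (PiLp.norm_apply_le x i).trans_lt hn
    rw [Real.norm_eq_abs, abs_lt] at this
    exact this
  have hlim := tendsto_measure_iInter_atTop (μ := volume.withDensity h)
    (fun n => (hQ n).compl.nullMeasurableSet) hmono
    ⟨0, by
      refine ((measure_mono (subset_univ _)).trans_lt ?_).ne
      rw [withDensity_apply _ MeasurableSet.univ, setLIntegral_univ]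
      exact hfin.lt_top⟩
  rw [hempty, measure_empty] at hlim
  obtain ⟨n, hn, hn0⟩ := ((hlim.eventually_lt_const hε).and (Filter.eventually_gt_atTop 0)).exists
  rw [Function.comp_apply, withDensity_apply _ (hQ n).compl] at hn
  exact ⟨n, hn0, hn⟩

end Grushin

open Grushin MeasureTheory Set in
open scoped ENNReal in
theorem proposition2p6 (d γ : ℕ) (hγ : 1 ≤ γ)
    (ω : Set (Grushin.Cylinder d))
    (hω : MeasureTheory.NullMeasurableSet ω MeasureTheory.volume)
    (hpos : 0 < MeasureTheory.volume ω)
    (lam : ℝ) (hlam : 0 < lam) (c : ℝ) (hc : 0 < c)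
    (hspec : ∀ f ∈ Grushin.spectralSubspace (Grushin.negGrushinGraph γ d) lam,
      MeasureTheory.eLpNorm f 2 MeasureTheory.volume ≤
        ENNReal.ofReal c * MeasureTheory.eLpNorm f 2 (MeasureTheory.volume.restrict ω)) :
    Grushin.IsThick ω := by
  obtain ⟨g, hg0, hg⟩ := exists_translates_mem_spectralSubspace d γ hlam
  set h : EuclideanSpace ℝ (Fin d) → ℝ≥0∞ := fun x => ‖g x‖ₑ ^ 2 with hh
  have hhm : Measurable h := by
    have := g.continuous
    have : Continuous h := by fun_prop
    exact this.measurable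
  set V := volume (univ : Set (Torus d)) with hV
  have hV0 : V ≠ 0 := volume_torus_ne_zero
  have hVtop : V ≠ ∞ := measure_ne_top _ _
  set N := ∫⁻ x, h x with hN
  have hNtop : N ≠ ∞ := by
    rw [hN, hh, ← eLpNorm_two_sq]
    exact ENNReal.pow_ne_top (g.memLp 2 volume).eLpNorm_ne_top
  have hN0 : N ≠ 0 := by
    intro h0
    rw [hN, hh, ← eLpNorm_two_sq, pow_eq_zero_iff two_ne_zero,
      eLpNorm_eq_zero_iff g.continuous.aestronglyMeasurable two_ne_zero] at h0
    have := (g.continuous.ae_eq_iff_eq volume continuous_const).1 h0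
    exact hg0 (DFunLike.coe_injective this)
  obtain ⟨M, hM⟩ : ∃ M : ℝ≥0∞, (M ≠ ∞ ∧ M ≠ 0) ∧ ∀ x, h x ≤ M := by
    refine ⟨ENNReal.ofReal (SchwartzMap.seminorm ℝ 0 0 g + 1) ^ 2, ⟨by finiteness, ?_⟩, fun x => ?_⟩
    · have : 0 < SchwartzMap.seminorm ℝ 0 0 g + 1 := by positivity
      positivity
    · simp only [hh]
      rw [← ofReal_norm]
      gcongr
      exact (SchwartzMap.norm_le_seminorm ℝ g x).trans (by linarith)
  set c' := ENNReal.ofReal c ^ 2 with hc'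
  have hc'0 : c' ≠ 0 := by positivity
  have hc'top : c' ≠ ∞ := ENNReal.pow_ne_top ENNReal.ofReal_ne_top
  have hNV0 : V * N ≠ 0 := mul_ne_zero hV0 hN0
  have hNVtop : V * N ≠ ∞ := ENNReal.mul_ne_top hVtop hNtop
  -- `n` is such that the mass outside the cube, times `c²`, is less than half of the total mass
  obtain ⟨n, hn0, hn⟩ := exists_cube_setLIntegral_compl_le hNtop
    (ε := V * N / 2 / (c' * V)) (ENNReal.div_pos (ENNReal.half_pos hNV0).ne'
      (ENNReal.mul_ne_top hc'top hVtop))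
  -- the mass inside the tube is at most `sup |g|²` times the measure of `ω` there
  have hmass : ∀ a b : EuclideanSpace ℝ (Fin d), V * N / 2 / (c' * M) ≤
      volume (ω ∩ cylinderBox (2 * n) (2 * Real.pi) a b) := by
    intro a b
    refine le_trans ?_ (measure_inter_tube_le ω (2 * n) a b)
    set T : Set (Cylinder d) := {z | ∀ i, z.1 i ∈ Ioo (a i) (a i + 2 * n)} with hT
    -- the centre of the cube, to which `g` is translated
    let m : EuclideanSpace ℝ (Fin d) := WithLp.toLp 2 fun i => a i + n
    have hTm : MeasurableSet T := by
      simp only [hT, ofPred_forall]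
      refine MeasurableSet.iInter fun i => ?_
      have : Measurable fun z : Cylinder d => z.1 i := by fun_prop
      exact this measurableSet_Ioo
    have h1 := pow_le_pow_left' (hspec _ (hg m)) 2
    rw [mul_pow, eLpNorm_congr_ae (coeFn_lift _),
      eLpNorm_congr_ae (ae_restrict_of_ae (coeFn_lift _)), eLpNorm_two_sq, eLpNorm_two_sq] at h1
    simp only [SchwartzMap.compSubConstCLM_apply] at h1
    have hshift : ∀ f : EuclideanSpace ℝ (Fin d) → ℝ≥0∞, Measurable f →
        ∫⁻ z : Cylinder d, f (z.1 - m) = V * ∫⁻ x, f x := by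
      intro f hf
      rw [lintegral_comp_fst (h := fun x => f (x - m)) (by fun_prop),
        lintegral_sub_right_eq_self f m]
    have h2 : ∫⁻ z in ω, h (z.1 - m) ≤ M * volume (ω ∩ T) + V * (V * N / 2 / (c' * V)) := by
      calc ∫⁻ z in ω, h (z.1 - m)
          ≤ ∫⁻ z in (ω ∩ T) ∪ Tᶜ, h (z.1 - m) := by
            refine lintegral_mono_set fun z hz => ?_
            by_cases hzT : z ∈ T
            · exact Or.inl ⟨hz, hzT⟩
            · exact Or.inr hzT
        _ ≤ (∫⁻ z in ω ∩ T, h (z.1 - m)) + ∫⁻ z in Tᶜ, h (z.1 - m) := lintegral_union_le _ _ _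
        _ ≤ _ := by
            gcongr ?_ + ?_
            · exact (lintegral_mono fun z => hM.2 _).trans (by simp)
            · set Q : Set (EuclideanSpace ℝ (Fin d)) := {x | ∀ i, x i ∈ Ioo (-(n : ℝ)) n} with hQ
              have hQm : MeasurableSet Q := by
                simp only [hQ, ofPred_forall]
                refine MeasurableSet.iInter fun i => ?_
                have : Measurable fun x : EuclideanSpace ℝ (Fin d) => x i := by fun_prop
                exact this measurableSet_Ioo
              have hind : ∀ z : Cylinder d, Tᶜ.indicator (fun z => h (z.1 - m)) z =
                  Qᶜ.indicator h (z.1 - m) := by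
                intro z
                have hiff : z ∈ Tᶜ ↔ z.1 - m ∈ Qᶜ := by
                  rw [mem_compl_iff, mem_compl_iff, not_iff_not]
                  refine forall_congr' fun i => ?_
                  simp only [mem_Ioo, PiLp.sub_apply, m]
                  constructor <;> rintro ⟨h1, h2⟩ <;> constructor <;> linarith
                by_cases hz : z ∈ Tᶜ
                · rw [indicator_of_mem hz, indicator_of_mem (hiff.1 hz)]
                · rw [indicator_of_notMem hz, indicator_of_notMem (mt hiff.2 hz)]
              rw [← lintegral_indicator hTm.compl]
              simp only [hind]
              rw [hshift _ (hhm.indicator hQm.compl), lintegral_indicator hQm.compl]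
              gcongr
    have h3 : V * N ≤ c' * M * volume (ω ∩ T) + V * N / 2 := by
      calc V * N ≤ c' * ∫⁻ z in ω, h (z.1 - m) := by rw [← hshift h hhm]; exact h1
        _ ≤ c' * (M * volume (ω ∩ T) + V * (V * N / 2 / (c' * V))) := by gcongr
        _ = _ := by
          rw [mul_add, ← mul_assoc, ← mul_assoc, ENNReal.mul_div_cancel (mul_ne_zero hc'0 hV0)
            (ENNReal.mul_ne_top hc'top hVtop)]
    have h4 : V * N / 2 ≤ c' * M * volume (ω ∩ T) := by
      conv at h3 => lhs; rw [← ENNReal.add_halves (V * N)]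
      exact (ENNReal.add_le_add_iff_right (ENNReal.div_ne_top hNVtop two_ne_zero)).1 h3
    exact ENNReal.div_le_of_le_mul' h4
  set δ := V * N / 2 / (c' * M) with hδ
  have hδ0 : δ ≠ 0 := (ENNReal.div_pos (ENNReal.half_pos hNV0).ne'
    (ENNReal.mul_ne_top hc'top hM.1.1)).ne'
  have hδtop : δ ≠ ∞ := ENNReal.div_ne_top (ENNReal.div_ne_top hNVtop two_ne_zero)
    (mul_ne_zero hc'0 hM.1.2)
  have hδpos : 0 < δ.toReal := ENNReal.toReal_pos hδ0 hδtop
  have hn : (0 : ℝ) < 2 * n := by positivity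
  have hbox : 0 < (2 * n : ℝ) ^ d * (2 * Real.pi) ^ d := by positivity
  refine ⟨min 1 (δ.toReal / ((2 * n : ℝ) ^ d * (2 * Real.pi) ^ d)), 2 * n, 2 * Real.pi,
    ⟨lt_min one_pos (by positivity), min_le_left _ _⟩, hn, ⟨Real.two_pi_pos, le_rfl⟩, fun a b => ?_⟩
  refine le_trans ?_ (hmass a b)
  refine ENNReal.ofReal_le_of_le_toReal ?_
  rw [mul_assoc, ← le_div_iff₀ hbox]
  exact min_le_right _ _

end
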